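/- Write $\mathscr P_2(\mathbb R^n)$ for the set of Borel probability measures on $\mathbb R^n$ with finite second moment and $\lambda$ for Lebesgue measure. For $\sigma,\nu\in\mathscr P_2(\mathbb R^n)$ with $\sigma\ll\lambda$, let $F_\sigma(\nu)=T_\sigma^\nu\in L^2(\mathbb R^n,\sigma)$ (linear optimal transportation, LOT) denote the optimal transport map from $\sigma$ to $\nu$, i.e. the map that minimizes $\int\|T(x)-x\|_2^2\,d\sigma(x)$ among all measurable maps $T$ with $T_\sharp\sigma=\nu$; this map exists in $L^2(\mathbb R^n,\sigma)$ and is unique up to $\sigma$-null sets, so that $F_\sigma$ is well defined on $\mathscr P_2(\mathbb R^n)$. For $\mu\in\mathscr P_2(\mathbb R^n)$, $F_\sigma$ is called compatible with $\mu$-pushforwards of a set $\mathcal H\subseteq L^2(\mathbb R^n,\mu)$ of functions if $$F_\sigma(h_\sharp\mu)=h\circ F_\sigma(\mu)\quad\text{in } L^2(\mathbb R^n,\sigma),\qquad\text{for every } h\in\mathcal H.$$ **Lemma.** Let $\sigma,\mu\in\mathscr P_2(\mathbb R^n)$ with $\sigma\ll\lambda$. Then $F_\sigma$ is well defined in the above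 sense, and: 1. If $n=1$, then $F_\sigma$ is compatible with $\mu$-pushforwards of the monotonically increasing (i.e. non-decreasing) functions $h:\mathbb R\to\mathbb R$ with $h\in L^2(\mathbb R,\mu)$. 2. For every $n\ge1$, $F_\sigma$ is compatible with $\mu$-pushforwards of the set $\mathcal E=\{S_a:a\in\mathbb R^n\}\cup\{R_c:c>0\}\subseteq L^2(\mathbb R^n,\mu)$ of all shifts $S_a(x)=a+x$ and all scalings $R_c(x)=cx$ by positive factors. -/

import Mathlib

open MeasureTheory
open scoped ENNReal

namespace LinOT

variable {E : Type*} [NormedAddCommGroup E] [MeasurableSpace E]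

/-- Membership in the space of Borel probability measures with finite second moment. -/
structure MemP2 (μ : Measure E) : Prop where
  isProbabilityMeasure : IsProbabilityMeasure μ
  secondMoment_lt_top : ∫⁻ x, ‖x‖ₑ ^ 2 ∂μ < ∞

/-- The Monge cost of a map `T` with source `σ`, for the squared-distance cost. -/
noncomputable def mongeCost (σ : Measure E) (T : E → E) : ℝ≥0∞ :=
  ∫⁻ x, ‖T x - x‖ₑ ^ 2 ∂σ

/-- `T ∈ L²(σ)` is an optimal transport map from `σ` to `ν`: it pushes `σ` to `ν` and has minimal
Monge cost among all maps that push `σ` to `ν`. -/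
structure IsOptimalTransportMap (σ ν : Measure E) (T : Lp E 2 σ) : Prop where
  map_eq : σ.map T = ν
  minimal : ∀ S : E → E, AEMeasurable S σ → σ.map S = ν → mongeCost σ T ≤ mongeCost σ S

open Classical in
/-- Linear optimal transportation `F_σ`: it sends `ν` to the optimal transport map from `σ`
to `ν`, an element of `L²(σ)` (and to `0` when there is no such map). -/
noncomputable def lot (σ ν : Measure E) : Lp E 2 σ :=
  if h : ∃ T : Lp E 2 σ, IsOptimalTransportMap σ ν T then h.choose else 0

/-- `F_σ` is well defined: every `ν` with finite second moment is the target of exactly one optimal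
transport map from `σ` in `L²(σ)`. -/
def LotWellDefined (σ : Measure E) : Prop :=
  ∀ ν : Measure E, MemP2 ν → ∃! T : Lp E 2 σ, IsOptimalTransportMap σ ν T

/-- `F_σ` is compatible with `μ`-pushforwards of a set `H ⊆ L²(μ)` of functions:
`F_σ(h_♯ μ) = h ∘ F_σ(μ)` in `L²(σ)` for all `h ∈ H`. The inclusion `H ⊆ L²(μ)` is part of the
assertion. -/
structure IsCompatible (σ μ : Measure E) (H : Set (E → E)) : Prop where
  memLp : ∀ h ∈ H, MemLp h 2 μ
  lot_map : ∀ h ∈ H, (lot σ (μ.map h) : E → E) =ᵐ[σ] h ∘ (lot σ μ : E → E)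

/-- The shift by `a`. -/
def shift (a : E) : E → E := fun x => a + x

/-- The scaling by `c`. -/
def scaling [NormedSpace ℝ E] (c : ℝ) : E → E := fun x => c • x

variable (E) in
/-- The set of all shifts, and all scalings by positive factors. -/
def shiftsAndScalings [NormedSpace ℝ E] : Set (E → E) :=
  {h | ∃ a : E, h = shift a} ∪ {h | ∃ c : ℝ, 0 < c ∧ h = scaling c}

end LinOT

/-! Well-definedness is Brenier's theorem. A minimal coupling exists by compactness. Its support is
cyclically monotone, hence by Rockafellar lies in the subdifferential of a convex function. That
function is differentiable Lebesgue-a.e. on its domain, so σ-a.e. as `σ ≪ m`, and the coupling is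
carried by a graph. Uniqueness follows because the average of two optimal graph plans is optimal, so
it too is carried by a single graph.

Compatibility with shifts and scalings: among maps with a prescribed law, minimal cost means maximal
correlation `∫ ⟪S x, x⟫`. A shift adds a constant to the correlation and a scaling multiplies it by
`c > 0`, so maximizers go to maximizers.

On the line, an optimal map is monotone on a conull set. Both `F_σ(h_♯ μ)` and `h ∘ F_σ(μ)` are
monotone there and have law `h_♯ μ`, which determines them σ-a.e. -/

namespace LinOT

open Filter Topology NNReal

open scoped RealInnerProductSpace

/-! ### Optimal couplings: existence and cyclical monotonicity of the support -/

section Plans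

variable {X Y : Type*} [MeasurableSpace X] [MeasurableSpace Y]

/-- `π` is a coupling of `σ` and `ν` of minimal cost, for the cost function `c`. -/
structure IsOptimalPlan (c : X × Y → ℝ≥0) (σ : Measure X) (ν : Measure Y)
    (π : Measure (X × Y)) : Prop where
  fst_eq : π.fst = σ
  snd_eq : π.snd = ν
  minimal : ∀ π' : Measure (X × Y), π'.fst = σ → π'.snd = ν →
    ∫⁻ z, c z ∂π ≤ ∫⁻ z, c z ∂π'

theorem fst_map_graph {σ : Measure X} {S : X → Y} (hS : AEMeasurable S σ) :
    (σ.map fun x => (x, S x)).fst = σ := by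
  rw [Measure.fst, AEMeasurable.map_map_of_aemeasurable measurable_fst.aemeasurable
    (aemeasurable_id'.prodMk hS)]
  exact Measure.map_id

theorem snd_map_graph {σ : Measure X} {S : X → Y} (hS : AEMeasurable S σ) :
    (σ.map fun x => (x, S x)).snd = σ.map S := by
  rw [Measure.snd, AEMeasurable.map_map_of_aemeasurable measurable_snd.aemeasurable
    (aemeasurable_id'.prodMk hS)]
  rfl

/-- The truncations `min (f x) n` are bounded and continuous, so their integrals are weakly
continuous; the integral of `f` is the supremum of these. -/
theorem lowerSemicontinuous_lintegral_coe [TopologicalSpace X] [OpensMeasurableSpace X]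
    {f : X → ℝ≥0} (hf : Continuous f) :
    LowerSemicontinuous fun μ : ProbabilityMeasure X => ∫⁻ x, f x ∂(μ : Measure X) := by
  have key : ∀ μ : ProbabilityMeasure X, ∫⁻ x, f x ∂(μ : Measure X) =
      ⨆ n : ℕ, ∫⁻ x, ((min (f x) n : ℝ≥0) : ℝ≥0∞) ∂(μ : Measure X) := by
    intro μ
    rw [← lintegral_iSup (fun n => (hf.min continuous_const).measurable.coe_nnreal_ennreal)]
    · refine lintegral_congr fun x => le_antisymm ?_ (iSup_le fun n => by simp)
      obtain ⟨n, hn⟩ := exists_nat_ge (f x)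
      exact le_iSup_of_le n (by simp [hn])
    · intro a b hab x
      have : (a : ℝ≥0) ≤ b := by exact_mod_cast hab
      exact ENNReal.coe_le_coe.2 (min_le_min le_rfl this)
  simp_rw [key]
  refine lowerSemicontinuous_iSup fun n => Continuous.lowerSemicontinuous ?_
  let g : BoundedContinuousFunction X ℝ≥0 :=
    BoundedContinuousFunction.mkOfBound ⟨fun x => min (f x) n, hf.min continuous_const⟩ n (by
      intro x y
      have h : ∀ x, ((min (f x) n : ℝ≥0) : ℝ) ≤ n := fun x => by
        exact_mod_cast min_le_right (f x) n
      simp only [ContinuousMap.coe_mk, NNReal.dist_eq]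
      exact abs_sub_le_of_nonneg_of_le NNReal.zero_le_coe (h x) NNReal.zero_le_coe (h y))
  exact ProbabilityMeasure.continuous_lintegral_boundedContinuousFunction g

/-- Direct method: the couplings form a weakly closed set, tight because both marginals are fixed,
hence compact by Prokhorov. -/
theorem exists_isOptimalPlan [TopologicalSpace X] [PolishSpace X] [BorelSpace X]
    [TopologicalSpace Y] [PolishSpace Y] [BorelSpace Y] {c : X × Y → ℝ≥0} (hc : Continuous c)
    (σ : Measure X) (ν : Measure Y) [IsProbabilityMeasure σ] [IsProbabilityMeasure ν] :
    ∃ π, IsOptimalPlan c σ ν π := by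
  let K : Set (ProbabilityMeasure (X × Y)) :=
    {π | (π : Measure (X × Y)).fst = σ ∧ (π : Measure (X × Y)).snd = ν}
  have hclosed : IsClosed K := by
    have h1 : IsClosed {π : ProbabilityMeasure (X × Y) |
        π.map continuous_fst.measurable.aemeasurable = (⟨σ, ‹_›⟩ : ProbabilityMeasure X)} :=
      isClosed_eq (ProbabilityMeasure.continuous_map continuous_fst) continuous_const
    have h2 : IsClosed {π : ProbabilityMeasure (X × Y) |
        π.map continuous_snd.measurable.aemeasurable = (⟨ν, ‹_›⟩ : ProbabilityMeasure Y)} :=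
      isClosed_eq (ProbabilityMeasure.continuous_map continuous_snd) continuous_const
    convert h1.inter h2 using 1
    ext π
    exact and_congr (Subtype.coe_inj (a := π.map continuous_fst.measurable.aemeasurable)
      (b := (⟨σ, ‹_›⟩ : ProbabilityMeasure X)))
      (Subtype.coe_inj (a := π.map continuous_snd.measurable.aemeasurable)
      (b := (⟨ν, ‹_›⟩ : ProbabilityMeasure Y)))
  have htight : IsTightMeasureSet {((π : ProbabilityMeasure (X × Y)) : Measure (X × Y)) | π ∈ K} := by
    refine IsTightMeasureSet.prodMk
      ((isTightMeasureSet_singleton (μ := σ)).subset ?_)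
      ((isTightMeasureSet_singleton (μ := ν)).subset ?_)
    · rintro _ ⟨_, ⟨π, hπ, rfl⟩, rfl⟩
      exact hπ.1
    · rintro _ ⟨_, ⟨π, hπ, rfl⟩, rfl⟩
      exact hπ.2
  have hK : IsCompact K := by
    rw [← hclosed.closure_eq]
    exact isCompact_closure_of_isTightMeasureSet htight
  have hne : K.Nonempty := ⟨⟨σ.prod ν, inferInstance⟩, Measure.fst_prod, Measure.snd_prod⟩
  obtain ⟨π, hπ, hmin⟩ := LowerSemicontinuousOn.exists_isMinOn hne hK
    ((lowerSemicontinuous_lintegral_coe hc).lowerSemicontinuousOn K)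
  refine ⟨π, hπ.1, hπ.2, fun π' h1 h2 => ?_⟩
  have : IsProbabilityMeasure π' := ⟨by rw [← Measure.fst_univ, h1]; simp⟩
  exact hmin (a := ⟨π', this⟩) ⟨h1, h2⟩

/-- The support of an optimal plan is cyclically monotone for the cost function. -/
theorem IsOptimalPlan.sum_le_sum [TopologicalSpace X] [SecondCountableTopology X]
    [TopologicalSpace Y] [SecondCountableTopology Y] [BorelSpace X] [BorelSpace Y]
    {c : X × Y → ℝ≥0} (hc : Continuous c)
    {σ : Measure X} {ν : Measure Y} [IsProbabilityMeasure σ] {π : Measure (X × Y)}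
    (hπ : IsOptimalPlan c σ ν π) (hfin : ∫⁻ z, c z ∂π ≠ ∞) {ι : Type*} [Fintype ι]
    (z : ι → X × Y) (hz : ∀ i, z i ∈ π.support) (τ : Equiv.Perm ι) :
    ∑ i, c (z i) ≤ ∑ i, c ((z (τ i)).1, (z i).2) := by
  classical
  have hprob : IsProbabilityMeasure π := ⟨by rw [← Measure.fst_univ, hπ.fst_eq]; simp⟩
  cases isEmpty_or_nonempty ι
  · simp
  suffices H : ∀ ε : ℝ≥0, 0 < ε → ∑ i, c (z i) ≤
      ∑ i, c ((z (τ i)).1, (z i).2) + 2 * Fintype.card ι * ε by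
    have ht : Tendsto (fun ε : ℝ≥0 => ∑ i, c ((z (τ i)).1, (z i).2) + 2 * Fintype.card ι * ε)
        (𝓝[>] 0) (𝓝 (∑ i, c ((z (τ i)).1, (z i).2) + 2 * Fintype.card ι * 0)) :=
      Continuous.tendsto' (by fun_prop) _ _ rfl |>.mono_left nhdsWithin_le_nhds
    rw [mul_zero, add_zero] at ht
    exact ge_of_tendsto ht (eventually_mem_nhdsWithin.mono H)
  intro ε hε
  have hU : ∀ i, ∃ U : Set X, ∃ V : Set Y, IsOpen U ∧ IsOpen V ∧ (z i).1 ∈ U ∧ (z i).2 ∈ V ∧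
      (∀ x ∈ U, ∀ y ∈ V, c (z i) ≤ c (x, y) + ε) := by
    intro i
    have : ∀ᶠ w in 𝓝 (z i), c (z i) < c w + ε :=
      (tendsto_const_nhds.eventually_lt ((hc.tendsto (z i)).add_const ε)
        (lt_add_of_pos_right _ hε))
    obtain ⟨U, V, hU, hxU, hV, hyV, h⟩ := mem_nhds_prod_iff'.1 this
    exact ⟨U, V, hU, hV, hxU, hyV, fun x hx y hy => (h (Set.mk_mem_prod hx hy)).le⟩
  have hU' : ∀ i, ∃ U : Set X, ∃ V : Set Y, IsOpen U ∧ IsOpen V ∧ (z (τ i)).1 ∈ U ∧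
      (z i).2 ∈ V ∧ (∀ x ∈ U, ∀ y ∈ V, c (x, y) ≤ c ((z (τ i)).1, (z i).2) + ε) := by
    intro i
    have : ∀ᶠ w in 𝓝 ((z (τ i)).1, (z i).2), c w < c ((z (τ i)).1, (z i).2) + ε :=
      (hc.tendsto _).eventually_lt tendsto_const_nhds (lt_add_of_pos_right _ hε)
    obtain ⟨U, V, hU, hxU, hV, hyV, h⟩ := mem_nhds_prod_iff'.1 this
    exact ⟨U, V, hU, hV, hxU, hyV, fun x hx y hy => (h (Set.mk_mem_prod hx hy)).le⟩
  choose U V hUo hVo hxU hyV hUV using hU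
  choose U' V' hUo' hVo' hxU' hyV' hUV' using hU'
  -- The point `(z i).1` also occurs in the permuted pair with index `τ.symm i`, so its
  -- neighbourhood must serve both pairs.
  let A : ι → Set X := fun i => U i ∩ U' (τ.symm i)
  let B : ι → Set Y := fun i => V i ∩ V' i
  have hA : ∀ i, IsOpen (A i) := fun i => (hUo i).inter (hUo' _)
  have hB : ∀ i, IsOpen (B i) := fun i => (hVo i).inter (hVo' _)
  have hzA : ∀ i, (z i).1 ∈ A i := fun i => ⟨hxU i, by simpa using hxU' (τ.symm i)⟩
  have hzB : ∀ i, (z i).2 ∈ B i := fun i => ⟨hyV i, hyV' i⟩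
  have hRm : ∀ i, MeasurableSet (A i ×ˢ B i) := fun i => ((hA i).prod (hB i)).measurableSet
  let α : ι → ℝ≥0∞ := fun i => π (A i ×ˢ B i)
  have hα : ∀ i, 0 < α i := fun i => (Measure.mem_support_iff_forall _).1 (hz i) _
    (((hA i).prod (hB i)).mem_nhds ⟨hzA i, hzB i⟩)
  let p : ι → Measure (X × Y) := fun i => ProbabilityTheory.cond π (A i ×ˢ B i)
  have hp : ∀ i, IsProbabilityMeasure (p i) := fun i =>
    ProbabilityTheory.cond_isProbabilityMeasure (hα i).ne'
  have hpR : ∀ i, ∀ᵐ w ∂(p i), w ∈ A i ×ˢ B i := fun i =>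
    Measure.ae_smul_measure (ae_restrict_mem (hRm i)) _
  have hpA : ∀ i, ∀ᵐ x ∂(p i).fst, x ∈ A i := fun i => by
    refine (ae_map_iff measurable_fst.aemeasurable (hA i).measurableSet).2 ?_
    exact (hpR i).mono fun w hw => hw.1
  have hpB : ∀ i, ∀ᵐ y ∂(p i).snd, y ∈ B i := fun i => by
    refine (ae_map_iff measurable_snd.aemeasurable (hB i).measurableSet).2 ?_
    exact (hpR i).mono fun w hw => hw.2
  obtain ⟨i₀, hi₀⟩ := Finite.exists_min α
  -- Small enough that each `η • p i` is at most `π / card ι`, whence `κ ≤ π`.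
  let η : ℝ≥0∞ := (Fintype.card ι : ℝ≥0∞)⁻¹ * α i₀
  have hη0 : η ≠ 0 := mul_ne_zero (by simp) (hα i₀).ne'
  have hηt : η ≠ ∞ := ENNReal.mul_ne_top (by simp) (measure_ne_top _ _)
  let κ : Measure (X × Y) := ∑ i, η • p i
  -- Rewiring the removed mass `κ` along `τ` keeps both marginals, so `π - κ + κ'` is a competitor;
  -- minimality then compares the costs of `κ` and `κ'`.
  let κ' : Measure (X × Y) := ∑ i, η • ((p (τ i)).fst.prod (p i).snd)
  have hκ : κ ≤ π := by
    have h1 : ∀ i, η • p i ≤ (Fintype.card ι : ℝ≥0∞)⁻¹ • π := by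
      intro i
      simp only [p, ProbabilityTheory.cond, smul_smul]
      have : η * (π (A i ×ˢ B i))⁻¹ ≤ (Fintype.card ι : ℝ≥0∞)⁻¹ := by
        rw [mul_assoc]
        refine mul_le_of_le_one_right' ?_
        rw [← div_eq_mul_inv]
        exact ENNReal.div_le_of_le_mul (by simpa using hi₀ i)
      refine Measure.le_iff'.2 fun s => ?_
      simp only [Measure.smul_apply, smul_eq_mul]
      exact mul_le_mul' this (Measure.restrict_apply_le _ _)
    calc κ ≤ ∑ i : ι, (Fintype.card ι : ℝ≥0∞)⁻¹ • π := Finset.sum_le_sum fun i _ => h1 i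
      _ = π := by
        rw [Finset.sum_const, Finset.card_univ, ← Nat.cast_smul_eq_nsmul ℝ≥0∞, smul_smul,
          ENNReal.mul_inv_cancel (by simp) (by simp), one_smul]
  have hκfin : IsFiniteMeasure κ := isFiniteMeasure_of_le π hκ
  have hsplit : π - κ + κ = π := Measure.sub_add_cancel_of_le hκ
  have hfst : κ'.fst = κ.fst := by
    calc κ'.fst = ∑ i, η • (p (τ i)).fst := by
          simp only [κ', Measure.fst, Measure.map_finset_sum measurable_fst.aemeasurable,
            Measure.map_smul]
          exact Finset.sum_congr rfl fun i _ => congrArg (η • ·) Measure.fst_prod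
      _ = ∑ i, η • (p i).fst := Equiv.sum_comp τ fun i => η • (p i).fst
      _ = κ.fst := by
          simp only [κ, Measure.fst, Measure.map_finset_sum measurable_fst.aemeasurable,
            Measure.map_smul]
  have hsnd : κ'.snd = κ.snd := by
    simp only [κ, κ', Measure.snd, Measure.map_finset_sum measurable_snd.aemeasurable,
      Measure.map_smul]
    exact Finset.sum_congr rfl fun i _ => congrArg (η • ·) Measure.snd_prod
  have hmin := hπ.minimal (π - κ + κ')
    (by rw [← hπ.fst_eq, Measure.fst_add, hfst, ← Measure.fst_add, hsplit])
    (by rw [← hπ.snd_eq, Measure.snd_add, hsnd, ← Measure.snd_add, hsplit])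
  nth_rw 1 [← hsplit] at hmin
  rw [lintegral_add_measure, lintegral_add_measure] at hmin
  have hcost : ∫⁻ w, c w ∂κ ≤ ∫⁻ w, c w ∂κ' := by
    refine (ENNReal.add_le_add_iff_left ?_).1 hmin
    exact ne_top_of_le_ne_top hfin (lintegral_mono' Measure.sub_le le_rfl)
  simp only [κ, κ', lintegral_finsetSum_measure, lintegral_smul_measure, smul_eq_mul,
    ← Finset.mul_sum] at hcost
  rw [ENNReal.mul_le_mul_iff_right hη0 hηt] at hcost
  have hlow : ∀ i, (c (z i) : ℝ≥0∞) ≤ ∫⁻ w, c w ∂(p i) + ε := by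
    intro i
    calc (c (z i) : ℝ≥0∞) = ∫⁻ _, c (z i) ∂(p i) := by simp
      _ ≤ ∫⁻ w, (c w + ε : ℝ≥0∞) ∂(p i) := by
        refine lintegral_mono_ae ((hpR i).mono fun w hw => ?_)
        exact_mod_cast hUV i w.1 hw.1.1 w.2 hw.2.1
      _ = _ := by rw [lintegral_add_right _ measurable_const]; simp
  have hup : ∀ i, ∫⁻ w, c w ∂((p (τ i)).fst.prod (p i).snd) ≤
      c ((z (τ i)).1, (z i).2) + ε := by
    intro i
    have hae : ∀ᵐ w ∂((p (τ i)).fst.prod (p i).snd), w.1 ∈ A (τ i) ∧ w.2 ∈ B i :=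
      (Measure.quasiMeasurePreserving_fst.ae (hpA _)).and
        (Measure.quasiMeasurePreserving_snd.ae (hpB _))
    calc ∫⁻ w, c w ∂((p (τ i)).fst.prod (p i).snd)
        ≤ ∫⁻ _, (c ((z (τ i)).1, (z i).2) + ε : ℝ≥0∞) ∂((p (τ i)).fst.prod (p i).snd) := by
          refine lintegral_mono_ae (hae.mono fun w hw => ?_)
          have := hUV' i w.1 (by simpa using hw.1.2) w.2 hw.2.2
          exact_mod_cast this
      _ = _ := by simp
  have hfinal : ∑ i, (c (z i) : ℝ≥0∞) ≤
      ∑ i, (c ((z (τ i)).1, (z i).2) : ℝ≥0∞) + 2 * Fintype.card ι * ε := by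
    calc ∑ i, (c (z i) : ℝ≥0∞) ≤ ∑ i, (∫⁻ w, c w ∂(p i) + ε) := Finset.sum_le_sum fun i _ => hlow i
      _ = ∑ i, ∫⁻ w, c w ∂(p i) + Fintype.card ι * ε := by simp [Finset.sum_add_distrib]
      _ ≤ ∑ i, (c ((z (τ i)).1, (z i).2) + ε : ℝ≥0∞) + Fintype.card ι * ε := by
        refine add_le_add_left (hcost.trans ?_) _
        exact (Finset.sum_le_sum fun i _ => hup i)
      _ = _ := by
        simp only [Finset.sum_add_distrib, Finset.sum_const, Finset.card_univ, nsmul_eq_mul]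
        ring
  exact_mod_cast hfinal

end Plans

/-! ### Rockafellar potentials and almost everywhere differentiability -/

section CyclicMonotonicity

variable {E : Type*} [NormedAddCommGroup E] [InnerProductSpace ℝ E]

/-- Cyclic monotonicity of a set of pairs in an inner product space. -/
def CyclicallyMonotone (Γ : Set (E × E)) : Prop :=
  ∀ (n : ℕ) (z : ℕ → E × E), (∀ i, z i ∈ Γ) →
    ∑ i ∈ Finset.range n, ⟪(z (i + 1)).1 - (z i).1, (z i).2⟫ + ⟪(z 0).1 - (z n).1, (z n).2⟫ ≤ 0

/-- The value at `x` of the affine function attached to a chain of pairs, as in Rockafellar's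
construction of a potential. -/
def chainValue (s : ℕ × (ℕ → E × E)) (x : E) : ℝ :=
  ∑ i ∈ Finset.range s.1, ⟪(s.2 (i + 1)).1 - (s.2 i).1, (s.2 i).2⟫ +
    ⟪x - (s.2 s.1).1, (s.2 s.1).2⟫

theorem chainValue_update (n : ℕ) (z : ℕ → E × E) (p : E × E) (x : E) :
    chainValue (n + 1, Function.update z (n + 1) p) x = chainValue (n, z) p.1 + ⟪x - p.1, p.2⟫ := by
  simp only [chainValue, Function.update_self, Finset.sum_range_succ]
  congr 2
  · refine Finset.sum_congr rfl fun i hi => ?_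
    have := Finset.mem_range.1 hi
    rw [Function.update_of_ne (by lia), Function.update_of_ne (by lia)]
  · rw [Function.update_of_ne (by lia)]

theorem chainValue_combo (s : ℕ × (ℕ → E × E)) (x y : E) {a b : ℝ} (hab : a + b = 1) :
    chainValue s (a • x + b • y) = a * chainValue s x + b * chainValue s y := by
  simp only [chainValue, inner_sub_left, inner_add_left, real_inner_smul_left]
  linear_combination (⟪(s.2 s.1).1, (s.2 s.1).2⟫ - ∑ i ∈ Finset.range s.1,
    (⟪(s.2 (i + 1)).1, (s.2 i).2⟫ - ⟪(s.2 i).1, (s.2 i).2⟫)) * hab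

/-- **Rockafellar's theorem**: a cyclically monotone set is contained in the subdifferential of a
convex function. -/
theorem CyclicallyMonotone.exists_convexOn {Γ : Set (E × E)} (hΓ : CyclicallyMonotone Γ) :
    ∃ (D : Set E) (φ : E → ℝ), ConvexOn ℝ D φ ∧
      ∀ p ∈ Γ, p.1 ∈ D ∧ ∀ x ∈ D, φ p.1 + ⟪x - p.1, p.2⟫ ≤ φ x := by
  rcases Γ.eq_empty_or_nonempty with rfl | ⟨p₀, hp₀⟩
  · exact ⟨∅, 0, convexOn_const 0 convex_empty, by simp⟩
  let S : Set (ℕ × (ℕ → E × E)) := {s | (∀ i, s.2 i ∈ Γ) ∧ s.2 0 = p₀}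
  have hS : Nonempty S := ⟨⟨(0, fun _ => p₀), fun _ => hp₀, rfl⟩⟩
  -- `D` is where the supremum over chains starting at `p₀` is finite; elsewhere the real `⨆` takes
  -- its default value.
  let D : Set E := {x | BddAbove (Set.range fun s : S => chainValue s.1 x)}
  let φ : E → ℝ := fun x => ⨆ s : S, chainValue s.1 x
  have hcomb : ∀ x ∈ D, ∀ y ∈ D, ∀ a b : ℝ, 0 ≤ a → 0 ≤ b → a + b = 1 → ∀ s : S,
      chainValue s.1 (a • x + b • y) ≤ a * φ x + b * φ y := by
    intro x hx y hy a b ha hb hab s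
    rw [chainValue_combo _ _ _ hab]
    exact add_le_add (mul_le_mul_of_nonneg_left (le_ciSup hx s) ha)
      (mul_le_mul_of_nonneg_left (le_ciSup hy s) hb)
  refine ⟨D, φ, ⟨fun x hx y hy a b ha hb hab => ?_, fun x hx y hy a b ha hb hab => ?_⟩,
    fun p hp => ⟨?_, fun x hx => ?_⟩⟩
  · exact ⟨_, Set.forall_mem_range.2 (hcomb x hx y hy a b ha hb hab)⟩
  · exact ciSup_le (hcomb x hx y hy a b ha hb hab)
  -- Appending `p` to a chain and closing it up at `p₀` gives a cycle; cyclic monotonicity bounds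
  -- the chain's value at `p.1`.
  · refine ⟨⟪p.1 - p₀.1, p.2⟫, Set.forall_mem_range.2 ?_⟩
    rintro ⟨⟨n, z⟩, hz, hz0⟩
    have h := hΓ (n + 1) (Function.update z (n + 1) p) (fun i => by
      by_cases hi : i = n + 1
      · rw [hi, Function.update_self]; exact hp
      · rw [Function.update_of_ne hi]; exact hz i)
    have h' := chainValue_update n z p p₀.1
    rw [Function.update_of_ne (by lia)] at h
    simp only at hz0
    rw [hz0] at h
    change chainValue (n + 1, Function.update z (n + 1) p) p₀.1 ≤ 0 at h
    rw [h', ← neg_sub, inner_neg_left] at h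
    simp only
    linarith
  -- Appending `p` to any chain gives another admissible chain, whose value at `x` is at most `φ x`.
  · rw [← le_sub_iff_add_le]
    refine ciSup_le fun s => ?_
    obtain ⟨⟨n, z⟩, hz, hz0⟩ := s
    rw [le_sub_iff_add_le]
    have h' := chainValue_update n z p x
    simp only
    rw [← h']
    refine le_ciSup hx (⟨(n + 1, Function.update z (n + 1) p), fun i => ?_, ?_⟩ : S)
    · by_cases hi : i = n + 1
      · simp only [hi, Function.update_self]; exact hp
      · simp only [Function.update_of_ne hi]; exact hz i
    · simpa using hz0

variable [FiniteDimensional ℝ E] [MeasurableSpace E] [BorelSpace E]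

/-- A convex function is differentiable almost everywhere in its domain. -/
theorem ae_differentiableAt_of_convexOn {m : Measure E} [m.IsAddHaarMeasure] {D : Set E} {φ : E → ℝ}
    (hφ : ConvexOn ℝ D φ) : ∀ᵐ x ∂m, x ∈ D → x ∈ interior D ∧ DifferentiableAt ℝ φ x := by
  have hlip := hφ.locallyLipschitzOn_interior
  have hfr : ∀ᵐ x ∂m, x ∉ frontier D := measure_eq_zero_iff_ae_notMem.1 (hφ.1.addHaar_frontier m)
  have hdiff : ∀ᵐ x ∂m, x ∈ interior D → DifferentiableAt ℝ φ x := by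
    have hnull : m {x | x ∈ interior D ∧ ¬ DifferentiableAt ℝ φ x} = 0 := by
      refine measure_null_of_locally_null _ fun x hx => ?_
      obtain ⟨K, t, ht, hK⟩ := hlip hx.1
      rw [isOpen_interior.nhdsWithin_eq hx.1] at ht
      refine ⟨interior t ∩ {x | x ∈ interior D ∧ ¬ DifferentiableAt ℝ φ x},
        Filter.inter_mem (mem_nhdsWithin_of_mem_nhds (interior_mem_nhds.2 ht))
          self_mem_nhdsWithin, ?_⟩
      have h := (hK.mono interior_subset).ae_differentiableWithinAt_of_mem (μ := m)
      refine measure_eq_zero_iff_ae_notMem.2 (h.mono fun y hy hy' => hy'.2.2 ?_)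
      exact (hy hy'.1).differentiableAt (isOpen_interior.mem_nhds hy'.1)
    filter_upwards [measure_eq_zero_iff_ae_notMem.1 hnull] with x hx hxD
    by_contra h
    exact hx ⟨hxD, h⟩
  filter_upwards [hfr, hdiff] with x h1 h2 hxD
  have : x ∈ interior D := by
    by_contra h
    exact h1 ⟨subset_closure hxD, h⟩
  exact ⟨this, h2 this⟩

/-- A cyclically monotone set is almost everywhere a graph. -/
theorem CyclicallyMonotone.exists_measurable_graph {m : Measure E} [m.IsAddHaarMeasure]
    {Γ : Set (E × E)} (hΓ : CyclicallyMonotone Γ) :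
    ∃ T : E → E, Measurable T ∧ ∀ᵐ x ∂m, ∀ y, (x, y) ∈ Γ → y = T x := by
  obtain ⟨D, φ, hφ, hsub⟩ := hΓ.exists_convexOn
  refine ⟨fun x => (InnerProductSpace.toDual ℝ E).symm (fderiv ℝ φ x),
    (InnerProductSpace.toDual ℝ E).symm.continuous.measurable.comp (measurable_fderiv ℝ φ), ?_⟩
  filter_upwards [ae_differentiableAt_of_convexOn (m := m) hφ] with x hx y hxy
  obtain ⟨hxD, hle⟩ := hsub _ hxy
  obtain ⟨hint, hd⟩ := hx hxD
  -- The subgradient inequality makes `φ - ⟪y, ·⟫` minimal at `x`, so `y` is the gradient of `φ`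
  -- there.
  have hmin : IsLocalMin (fun w => φ w - InnerProductSpace.toDual ℝ E y w) x := by
    filter_upwards [mem_interior_iff_mem_nhds.1 hint] with w hw
    have := hle w hw
    simp only [inner_sub_left] at this
    simp only [InnerProductSpace.toDual_apply_apply, real_inner_comm _ y] at this ⊢
    linarith
  have h0 := hmin.hasFDerivAt_eq_zero
    (hd.hasFDerivAt.sub (InnerProductSpace.toDual ℝ E y).hasFDerivAt)
  rw [sub_eq_zero.1 h0]
  simp

end CyclicMonotonicity

/-! ### Brenier's theorem -/

section Brenier

variable {E : Type*} [NormedAddCommGroup E]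

/-- The squared-distance cost. -/
def sqCost (z : E × E) : ℝ≥0 := ‖z.2 - z.1‖₊ ^ 2

theorem continuous_sqCost : Continuous (sqCost : E × E → ℝ≥0) := by
  unfold sqCost; fun_prop

theorem coe_sqCost (z : E × E) : (sqCost z : ℝ≥0∞) = ‖z.2 - z.1‖ₑ ^ 2 := by
  simp [sqCost, enorm_eq_nnnorm]

section Lot

variable [MeasurableSpace E]

theorem LotWellDefined.isOptimalTransportMap_lot {σ ν : Measure E} (h : LotWellDefined σ)
    (hν : MemP2 ν) : IsOptimalTransportMap σ ν (lot σ ν) := by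
  have hex := (h ν hν).exists
  rw [lot, dif_pos hex]
  exact hex.choose_spec

theorem LotWellDefined.lot_eq {σ ν : Measure E} (h : LotWellDefined σ) (hν : MemP2 ν)
    {T : Lp E 2 σ} (hT : IsOptimalTransportMap σ ν T) : lot σ ν = T :=
  (h ν hν).unique (h.isOptimalTransportMap_lot hν) hT

end Lot

variable [InnerProductSpace ℝ E]

/-- On expanding the squares, the norm terms cancel because `τ` only reindexes them. -/
theorem sum_inner_le_of_sum_sqCost_le {ι : Type*} [Fintype ι] (z : ι → E × E) (τ : Equiv.Perm ι)
    (h : ∑ i, sqCost (z i) ≤ ∑ i, sqCost ((z (τ i)).1, (z i).2)) :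
    ∑ i, ⟪(z (τ i)).1, (z i).2⟫ ≤ ∑ i, ⟪(z i).1, (z i).2⟫ := by
  have h' : ∑ i, ‖(z i).2 - (z i).1‖ ^ 2 ≤ ∑ i, ‖(z i).2 - (z (τ i)).1‖ ^ 2 := by
    have := NNReal.coe_le_coe.2 h
    simpa [sqCost] using this
  simp only [norm_sub_sq_real, Finset.sum_add_distrib, Finset.sum_sub_distrib,
    ← Finset.mul_sum] at h'
  rw [Equiv.sum_comp τ fun i => ‖(z i).1‖ ^ 2] at h'
  simp only [real_inner_comm (z _).2]
  linarith

variable [FiniteDimensional ℝ E] [MeasurableSpace E] [BorelSpace E]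

theorem IsOptimalPlan.sum_inner_le {σ ν : Measure E} [IsProbabilityMeasure σ] {π : Measure (E × E)}
    (hπ : IsOptimalPlan sqCost σ ν π) (hfin : ∫⁻ z, sqCost z ∂π ≠ ∞) {ι : Type*} [Fintype ι]
    (z : ι → E × E) (hz : ∀ i, z i ∈ π.support) (τ : Equiv.Perm ι) :
    ∑ i, ⟪(z (τ i)).1, (z i).2⟫ ≤ ∑ i, ⟪(z i).1, (z i).2⟫ :=
  sum_inner_le_of_sum_sqCost_le z τ (hπ.sum_le_sum continuous_sqCost hfin z hz τ)

theorem IsOptimalPlan.cyclicallyMonotone {σ ν : Measure E} [IsProbabilityMeasure σ]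
    {π : Measure (E × E)} (hπ : IsOptimalPlan sqCost σ ν π) (hfin : ∫⁻ z, sqCost z ∂π ≠ ∞) :
    CyclicallyMonotone π.support := by
  intro n z hz
  have h := hπ.sum_inner_le hfin (fun i : Fin (n + 1) => z i) (fun i => hz i) (finRotate (n + 1))
  rw [← sub_nonpos, ← Finset.sum_sub_distrib] at h
  simp only [← inner_sub_left, Fin.sum_univ_castSucc, finRotate_apply,
    Fin.coeSucc_eq_succ, Fin.val_succ, Fin.val_castSucc, Fin.last_add_one, Fin.val_last,
    Fin.val_zero] at h
  rwa [Finset.sum_range]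

theorem MemP2.lintegral_sqCost_ne_top {σ ν : Measure E} (hσ : MemP2 σ) (hν : MemP2 ν)
    {π : Measure (E × E)} (h1 : π.fst = σ) (h2 : π.snd = ν) : ∫⁻ z, sqCost z ∂π ≠ ∞ := by
  have hle : ∀ z : E × E, (sqCost z : ℝ≥0∞) ≤ 2 * ‖z.1‖ₑ ^ 2 + 2 * ‖z.2‖ₑ ^ 2 := by
    intro z
    simp only [sqCost, enorm_eq_nnnorm]
    norm_cast
    rw [← NNReal.coe_le_coe]
    push_cast
    have := norm_sub_le z.2 z.1
    nlinarith [sq_nonneg (‖z.2‖ - ‖z.1‖), norm_nonneg (z.2 - z.1), norm_nonneg z.1,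
      norm_nonneg z.2]
  refine ne_top_of_le_ne_top ?_ (lintegral_mono hle)
  have e1 : ∫⁻ z, ‖z.1‖ₑ ^ 2 ∂π = ∫⁻ x, ‖x‖ₑ ^ 2 ∂σ := by
    rw [← h1, Measure.fst, lintegral_map (by fun_prop) measurable_fst]
  have e2 : ∫⁻ z, ‖z.2‖ₑ ^ 2 ∂π = ∫⁻ x, ‖x‖ₑ ^ 2 ∂ν := by
    rw [← h2, Measure.snd, lintegral_map (by fun_prop) measurable_snd]
  rw [lintegral_add_left (by fun_prop), lintegral_const_mul _ (by fun_prop),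
    lintegral_const_mul _ (by fun_prop), e1, e2]
  exact ENNReal.add_ne_top.2 ⟨ENNReal.mul_ne_top (by simp) hσ.2.ne,
    ENNReal.mul_ne_top (by simp) hν.2.ne⟩

/-- An optimal plan whose source is absolutely continuous is carried by a graph. -/
theorem IsOptimalPlan.exists_graph {m : Measure E} [m.IsAddHaarMeasure] {σ ν : Measure E}
    (hσ : MemP2 σ) (hν : MemP2 ν) (hm : σ ≪ m) {π : Measure (E × E)}
    (hπ : IsOptimalPlan sqCost σ ν π) : ∃ T : E → E, Measurable T ∧ ∀ᵐ z ∂π, z.2 = T z.1 := by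
  have := hσ.1
  obtain ⟨T, hT, hae⟩ := (hπ.cyclicallyMonotone
    (hσ.lintegral_sqCost_ne_top hν hπ.fst_eq hπ.snd_eq)).exists_measurable_graph (m := m)
  refine ⟨T, hT, ?_⟩
  have h := hm.ae_le hae
  rw [← hπ.fst_eq] at h
  filter_upwards [ae_of_ae_map measurable_fst.aemeasurable h, π.support_mem_ae] with z h1 h2
  exact h1 z.2 h2

section Graph

variable {σ ν : Measure E} {S : E → E}

theorem lintegral_sqCost_map_graph (hS : AEMeasurable S σ) :
    ∫⁻ z, sqCost z ∂(σ.map fun x => (x, S x)) = mongeCost σ S := by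
  rw [lintegral_map' continuous_sqCost.measurable.coe_nnreal_ennreal.aemeasurable
    (aemeasurable_id'.prodMk hS)]
  simp only [coe_sqCost, mongeCost]

theorem memLp_of_map_eq (hν : MemP2 ν) (hS : AEMeasurable S σ) (h : σ.map S = ν) :
    MemLp S 2 σ := by
  refine ⟨hS.aestronglyMeasurable, ?_⟩
  rw [eLpNorm_lt_top_iff_lintegral_rpow_enorm_lt_top (by simp) (by simp)]
  have := hν.2
  rw [← h, lintegral_map' (by fun_prop) hS] at this
  simpa using this

end Graph

/-- The plan carried by the graph of an optimal transport map is an optimal plan. -/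
theorem IsOptimalTransportMap.isOptimalPlan {m : Measure E} [m.IsAddHaarMeasure] {σ ν : Measure E}
    (hσ : MemP2 σ) (hν : MemP2 ν) (hm : σ ≪ m) {T : Lp E 2 σ}
    (hT : IsOptimalTransportMap σ ν T) :
    IsOptimalPlan sqCost σ ν (σ.map fun x => (x, T x)) := by
  have := hσ.1
  have := hν.1
  have hTm : AEMeasurable T σ := (Lp.aestronglyMeasurable T).aemeasurable
  -- Optimality among maps gives optimality among couplings because some optimal coupling is itself
  -- carried by a graph.
  obtain ⟨π, hπ⟩ := exists_isOptimalPlan (continuous_sqCost (E := E)) σ ν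
  obtain ⟨S, hS, hSπ⟩ := hπ.exists_graph hσ hν hm
  have hπS : π = σ.map fun x => (x, S x) := by
    calc π = π.map id := Measure.map_id.symm
      _ = π.map fun z => (z.1, S z.1) := Measure.map_congr (hSπ.mono fun z hz => by
          simp [← hz])
      _ = σ.map fun x => (x, S x) := by
          rw [← hπ.fst_eq, Measure.fst, Measure.map_map (by fun_prop) measurable_fst]
          rfl
  refine ⟨fst_map_graph hTm, (snd_map_graph hTm).trans hT.map_eq, fun π' h1 h2 => ?_⟩
  refine le_trans ?_ (hπ.minimal π' h1 h2)
  rw [hπS, lintegral_sqCost_map_graph hTm, lintegral_sqCost_map_graph hS.aemeasurable]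
  refine hT.minimal S hS.aemeasurable ?_
  rw [← snd_map_graph hS.aemeasurable, ← hπS, hπ.snd_eq]

theorem exists_isOptimalTransportMap {m : Measure E} [m.IsAddHaarMeasure] {σ ν : Measure E}
    (hσ : MemP2 σ) (hν : MemP2 ν) (hm : σ ≪ m) : ∃ T : Lp E 2 σ, IsOptimalTransportMap σ ν T := by
  have := hσ.1
  have := hν.1
  obtain ⟨π, hπ⟩ := exists_isOptimalPlan (continuous_sqCost (E := E)) σ ν
  obtain ⟨S, hS, hSπ⟩ := hπ.exists_graph hσ hν hm
  have hmap : σ.map S = ν := by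
    rw [← hπ.fst_eq, ← hπ.snd_eq, Measure.fst, Measure.map_map hS measurable_fst]
    exact Measure.map_congr (hSπ.mono fun z hz => hz.symm)
  have hL := memLp_of_map_eq hν hS.aemeasurable hmap
  refine ⟨hL.toLp S, (Measure.map_congr hL.coeFn_toLp).trans hmap, fun R hR hRν => ?_⟩
  have hcost : mongeCost σ (hL.toLp S) = ∫⁻ z, sqCost z ∂π := by
    calc mongeCost σ (hL.toLp S) = ∫⁻ x, ‖S x - x‖ₑ ^ 2 ∂σ :=
          lintegral_congr_ae (hL.coeFn_toLp.mono fun x hx => by simp only [hx])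
      _ = ∫⁻ z, ‖S z.1 - z.1‖ₑ ^ 2 ∂π := by
          rw [← hπ.fst_eq, Measure.fst, lintegral_map (by fun_prop) measurable_fst]
      _ = _ := lintegral_congr_ae (hSπ.mono fun z hz => by simp only [coe_sqCost, hz])
  rw [hcost, ← lintegral_sqCost_map_graph hR]
  exact hπ.minimal _ (fst_map_graph hR) ((snd_map_graph hR).trans hRν)

/-- **Brenier's theorem**, existence and uniqueness of optimal transport maps. -/
theorem lotWellDefined_of_absolutelyContinuous {m : Measure E} [m.IsAddHaarMeasure] {σ : Measure E}
    (hσ : MemP2 σ) (hm : σ ≪ m) : LotWellDefined σ := by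
  intro ν hν
  refine existsUnique_of_exists_of_unique (exists_isOptimalTransportMap hσ hν hm)
    fun T₁ T₂ h₁ h₂ => Lp.ext ?_
  have hm₁ : AEMeasurable T₁ σ := (Lp.aestronglyMeasurable T₁).aemeasurable
  have hm₂ : AEMeasurable T₂ σ := (Lp.aestronglyMeasurable T₂).aemeasurable
  have hp₁ := h₁.isOptimalPlan hσ hν hm
  have hp₂ := h₂.isOptimalPlan hσ hν hm
  have half : ∀ {α : Type _} [MeasurableSpace α] (ρ : Measure α),
      (2⁻¹ : ℝ≥0∞) • ρ + (2⁻¹ : ℝ≥0∞) • ρ = ρ := fun ρ => by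
    rw [← add_smul, ENNReal.inv_two_add_inv_two, one_smul]
  -- The averaged plan is optimal, so one map `R` must agree a.e. with both `T₁` and `T₂`.
  let π : Measure (E × E) := (2⁻¹ : ℝ≥0∞) • (σ.map fun x => (x, T₁ x)) +
    (2⁻¹ : ℝ≥0∞) • (σ.map fun x => (x, T₂ x))
  have hπ : IsOptimalPlan sqCost σ ν π := by
    refine ⟨?_, ?_, fun π' h1 h2 => ?_⟩
    · simp only [π, Measure.fst_add]
      simp only [Measure.fst, Measure.map_smul]
      rw [← Measure.fst, ← Measure.fst, hp₁.fst_eq, hp₂.fst_eq, half]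
    · simp only [π, Measure.snd_add]
      simp only [Measure.snd, Measure.map_smul]
      rw [← Measure.snd, ← Measure.snd, hp₁.snd_eq, hp₂.snd_eq, half]
    · simp only [π, lintegral_add_measure, lintegral_smul_measure]
      refine (add_le_add (smul_le_smul_of_nonneg_left (hp₁.minimal π' h1 h2) zero_le)
        (smul_le_smul_of_nonneg_left (hp₂.minimal π' h1 h2) zero_le)).trans_eq ?_
      rw [← add_smul, ENNReal.inv_two_add_inv_two, one_smul]
  obtain ⟨R, -, hR⟩ := hπ.exists_graph hσ hν hm
  rw [ae_add_measure_iff] at hR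
  have hR₁ := ae_of_ae_map (aemeasurable_id'.prodMk hm₁)
    ((Measure.ae_ennreal_smul_measure_iff (by simp)).1 hR.1)
  have hR₂ := ae_of_ae_map (aemeasurable_id'.prodMk hm₂)
    ((Measure.ae_ennreal_smul_measure_iff (by simp)).1 hR.2)
  filter_upwards [hR₁, hR₂] with x hx₁ hx₂
  exact hx₁.trans hx₂.symm

theorem MemP2.map {μ : Measure E} (hμ : MemP2 μ) {h : E → E} (hh : MemLp h 2 μ) :
    MemP2 (μ.map h) := by
  have := hμ.1
  have hm := hh.1.aemeasurable
  refine ⟨Measure.isProbabilityMeasure_map hm, ?_⟩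
  rw [lintegral_map' (by fun_prop) hm]
  have := (eLpNorm_lt_top_iff_lintegral_rpow_enorm_lt_top (by simp) (by simp)).1 hh.2
  simpa using this

theorem MemP2.memLp_id {μ : Measure E} (hμ : MemP2 μ) : MemLp (fun x : E => x) 2 μ :=
  memLp_of_map_eq hμ aemeasurable_id' Measure.map_id'

end Brenier

/-! ### Compatibility with pushforwards -/

section Compatibility

variable {E : Type*} [NormedAddCommGroup E] [InnerProductSpace ℝ E] [FiniteDimensional ℝ E]
  [MeasurableSpace E] [BorelSpace E]

theorem integrable_inner_id {σ : Measure E} (hσ : MemP2 σ) {S : E → E} (hS : MemLp S 2 σ) :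
    Integrable (fun x => ⟪S x, x⟫) σ := by
  have h := L2.integrable_inner (𝕜 := ℝ) (hS.toLp S) (hσ.memLp_id.toLp _)
  refine h.congr ?_
  filter_upwards [hS.coeFn_toLp, hσ.memLp_id.coeFn_toLp] with x h1 h2
  rw [h1, h2]

/-- The law of `S` fixes `∫ ‖S x‖ ^ 2`, so only the correlation term depends on the choice of `S`.
-/
theorem mongeCost_eq_ofReal {σ ν : Measure E} (hσ : MemP2 σ) (hν : MemP2 ν) {S : E → E}
    (hS : AEMeasurable S σ) (h : σ.map S = ν) :
    mongeCost σ S = ENNReal.ofReal (∫ x, ‖S x - x‖ ^ 2 ∂σ) ∧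
      ∫ x, ‖S x - x‖ ^ 2 ∂σ =
        ∫ y, ‖y‖ ^ 2 ∂ν - 2 * ∫ x, ⟪S x, x⟫ ∂σ + ∫ x, ‖x‖ ^ 2 ∂σ := by
  have hL := memLp_of_map_eq hν hS h
  have hid := hσ.memLp_id
  have hd : MemLp (fun x => S x - x) 2 σ := hL.sub hid
  have hi := (memLp_two_iff_integrable_sq_norm hd.1).1 hd
  have hi₁ := (memLp_two_iff_integrable_sq_norm hL.1).1 hL
  have hi₂ := (memLp_two_iff_integrable_sq_norm hid.1).1 hid
  have hi₃ := (integrable_inner_id hσ hL).const_mul 2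
  have hi₄ : Integrable (fun x => ‖S x‖ ^ 2 - 2 * ⟪S x, x⟫) σ := hi₁.sub hi₃
  constructor
  · rw [ofReal_integral_eq_lintegral_ofReal hi (ae_of_all _ fun x => by positivity), mongeCost]
    refine lintegral_congr fun x => ?_
    rw [ENNReal.ofReal_pow (norm_nonneg _), ofReal_norm]
  · simp only [norm_sub_sq_real]
    rw [integral_add hi₄ hi₂, integral_sub hi₁ hi₃, integral_const_mul, ← h,
      integral_map hS (by fun_prop)]

/-- Among maps with the same law, a smaller Monge cost means a larger correlation. -/
theorem mongeCost_le_mongeCost_iff {σ ν : Measure E} (hσ : MemP2 σ) (hν : MemP2 ν) {S R : E → E}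
    (hS : AEMeasurable S σ) (hR : AEMeasurable R σ) (hSν : σ.map S = ν) (hRν : σ.map R = ν) :
    mongeCost σ S ≤ mongeCost σ R ↔ ∫ x, ⟪R x, x⟫ ∂σ ≤ ∫ x, ⟪S x, x⟫ ∂σ := by
  obtain ⟨h1, h2⟩ := mongeCost_eq_ofReal hσ hν hS hSν
  obtain ⟨h3, h4⟩ := mongeCost_eq_ofReal hσ hν hR hRν
  rw [h1, h3, ENNReal.ofReal_le_ofReal_iff (integral_nonneg fun x => by positivity), h2, h4]
  constructor <;> intro h <;> linarith

/-- If `h` is invertible with inverse `g`, and composition with `g` preserves the order of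
correlations, then `h` transports optimal maps to optimal maps. -/
theorem lot_map_ae_eq_of_inverse {σ μ : Measure E} (hσ : MemP2 σ) (hμ : MemP2 μ)
    (hwd : LotWellDefined σ) {h g : E → E} (hh : Measurable h) (hg : Measurable g)
    (hhL : MemLp h 2 μ) (hgh : ∀ x, g (h x) = x)
    (hcorr : ∀ S R : E → E, MemLp S 2 σ → MemLp R 2 σ →
      ∫ x, ⟪g (S x), x⟫ ∂σ ≤ ∫ x, ⟪R x, x⟫ ∂σ → ∫ x, ⟪S x, x⟫ ∂σ ≤ ∫ x, ⟪h (R x), x⟫ ∂σ) :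
    (lot σ (μ.map h) : E → E) =ᵐ[σ] h ∘ (lot σ μ : E → E) := by
  have hT := hwd.isOptimalTransportMap_lot hμ
  have hν := hμ.map hhL
  have hTm : AEMeasurable (lot σ μ) σ := (Lp.aestronglyMeasurable _).aemeasurable
  have hhT : AEMeasurable (h ∘ lot σ μ) σ := hh.comp_aemeasurable hTm
  have hlaw : σ.map (h ∘ lot σ μ) = μ.map h := by
    rw [← AEMeasurable.map_map_of_aemeasurable hh.aemeasurable hTm, hT.map_eq]
  have hL := memLp_of_map_eq hν hhT hlaw
  have hopt : IsOptimalTransportMap σ (μ.map h) (hL.toLp _) := by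
    refine ⟨(Measure.map_congr hL.coeFn_toLp).trans hlaw, fun S hS hSν => ?_⟩
    -- A competitor `S` for `μ.map h` pulls back to a competitor `g ∘ S` for `μ`.
    have hgS : σ.map (g ∘ S) = μ := by
      rw [← AEMeasurable.map_map_of_aemeasurable hg.aemeasurable hS, hSν, Measure.map_map hg hh]
      convert Measure.map_id
      exact funext hgh
    have hcost : mongeCost σ (hL.toLp _) = mongeCost σ (h ∘ lot σ μ) :=
      lintegral_congr_ae (hL.coeFn_toLp.mono fun x hx => by simp only [hx])
    rw [hcost, mongeCost_le_mongeCost_iff hσ hν hhT hS hlaw hSν]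
    have hgSm := hg.comp_aemeasurable hS
    refine hcorr S _ (memLp_of_map_eq hν hS hSν) (Lp.memLp _) ?_
    exact (mongeCost_le_mongeCost_iff hσ hμ hTm hgSm hT.map_eq hgS).1 (hT.minimal _ hgSm hgS)
  rw [hwd.lot_eq hν hopt]
  exact hL.coeFn_toLp

theorem isCompatible_shiftsAndScalings {σ μ : Measure E} (hσ : MemP2 σ) (hμ : MemP2 μ)
    (hwd : LotWellDefined σ) : IsCompatible σ μ (shiftsAndScalings E) := by
  have := hσ.1
  have := hμ.1
  have hshift : ∀ a : E, MemLp (shift a) 2 μ := fun a => (memLp_const a).add hμ.memLp_id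
  have hscaling : ∀ c : ℝ, MemLp (scaling c : E → E) 2 μ := fun c => hμ.memLp_id.const_smul c
  constructor
  · rintro h (⟨a, rfl⟩ | ⟨c, -, rfl⟩)
    exacts [hshift a, hscaling c]
  · rintro h (⟨a, rfl⟩ | ⟨c, hc, rfl⟩)
    · refine lot_map_ae_eq_of_inverse hσ hμ hwd (g := fun x => x - a) (measurable_const_add a)
        (measurable_id.sub_const a) (hshift a) (fun x => by simp [shift]) fun S R hS hR hle => ?_
      have ha := integrable_inner_id hσ (memLp_const (p := 2) (μ := σ) a)
      simp only [shift, inner_sub_left, inner_add_left] at hle ⊢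
      rw [integral_sub (integrable_inner_id hσ hS) ha] at hle
      rw [integral_add ha (integrable_inner_id hσ hR)]
      linarith
    · refine lot_map_ae_eq_of_inverse hσ hμ hwd (g := fun x => c⁻¹ • x) (measurable_const_smul c)
        (measurable_const_smul c⁻¹) (hscaling c)
        (fun x => by simp [scaling, smul_smul, hc.ne']) fun S R hS hR hle => ?_
      simp only [scaling, real_inner_smul_left, integral_const_mul] at hle ⊢
      rwa [inv_mul_le_iff₀ hc] at hle

/-- Optimal transport maps of the real line are monotone on a conull set. -/
theorem IsOptimalTransportMap.exists_monotoneOn {σ ν : Measure ℝ} (hσ : MemP2 σ) (hν : MemP2 ν)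
    (hm : σ ≪ volume) {T : Lp ℝ 2 σ} (hT : IsOptimalTransportMap σ ν T) :
    ∃ A ∈ ae σ, MonotoneOn T A := by
  have := hσ.1
  have hTm : AEMeasurable T σ := (Lp.aestronglyMeasurable T).aemeasurable
  have hp := hT.isOptimalPlan hσ hν hm
  have hfin := hσ.lintegral_sqCost_ne_top hν hp.fst_eq hp.snd_eq
  refine ⟨_, ae_of_ae_map (aemeasurable_id'.prodMk hTm) Measure.support_mem_ae,
    fun x hx y hy hxy => ?_⟩
  rcases hxy.eq_or_lt with rfl | hlt
  · exact le_rfl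
  -- Swapping the targets of two points gives `(T y - T x) * (y - x) ≥ 0`.
  have h := hp.sum_inner_le hfin ![(x, T x), (y, T y)]
    (Fin.forall_fin_two.2 ⟨hx, hy⟩) (Equiv.swap 0 1)
  simp [Fin.sum_univ_two] at h
  nlinarith

/-- Two functions that are monotone on a conull set and have the same law agree almost
everywhere. -/
theorem ae_eq_of_monotoneOn_of_map_eq {σ : Measure ℝ} [IsFiniteMeasure σ] {T R : ℝ → ℝ} {A : Set ℝ}
    (hA : A ∈ ae σ) (hT : MonotoneOn T A) (hR : MonotoneOn R A) (hTm : AEMeasurable T σ)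
    (hRm : AEMeasurable R σ) (h : σ.map T = σ.map R) : T =ᵐ[σ] R := by
  have key : ∀ q : ℚ, ∀ᵐ x ∂σ, T x ≤ q ↔ R x ≤ q := by
    intro q
    have hTn : NullMeasurableSet (T ⁻¹' Set.Iic (q : ℝ)) σ := hTm.nullMeasurable measurableSet_Iic
    have hRn : NullMeasurableSet (R ⁻¹' Set.Iic (q : ℝ)) σ := hRm.nullMeasurable measurableSet_Iic
    have heq : σ (T ⁻¹' Set.Iic (q : ℝ)) = σ (R ⁻¹' Set.Iic (q : ℝ)) := by
      rw [← Measure.map_apply_of_aemeasurable hTm measurableSet_Iic, h,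
        Measure.map_apply_of_aemeasurable hRm measurableSet_Iic]
    -- Within `A`, both sublevel sets are initial segments, hence nested; having equal finite
    -- measure, they coincide a.e.
    have hnested : (∀ x ∈ A, T x ≤ q → R x ≤ q) ∨ (∀ x ∈ A, R x ≤ q → T x ≤ q) := by
      by_contra! hcon
      obtain ⟨⟨x, hx, hx1, hx2⟩, y, hy, hy1, hy2⟩ := hcon
      rcases le_total x y with hxy | hxy
      · exact absurd ((hR hx hy hxy).trans hy1) (not_le.2 hx2)
      · exact absurd ((hT hy hx hxy).trans hx1) (not_le.2 hy2)
    have hae : T ⁻¹' Set.Iic (q : ℝ) =ᵐ[σ] R ⁻¹' Set.Iic (q : ℝ) := by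
      rcases hnested with hsub | hsub
      · refine ae_eq_of_ae_subset_of_measure_ge ?_ heq.ge hTn (measure_ne_top _ _)
        filter_upwards [hA] with x hx using hsub x hx
      · refine (ae_eq_of_ae_subset_of_measure_ge ?_ heq.le hRn (measure_ne_top _ _)).symm
        filter_upwards [hA] with x hx using hsub x hx
    exact hae.mem_iff
  filter_upwards [ae_all_iff.2 key] with x hx
  refine le_antisymm (le_of_forall_lt_rat_imp_le fun q hq => (hx q).2 hq.le)
    (le_of_forall_lt_rat_imp_le fun q hq => (hx q).1 hq.le)

theorem isCompatible_monotone {σ μ : Measure ℝ} (hσ : MemP2 σ) (hμ : MemP2 μ) (hm : σ ≪ volume) :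
    IsCompatible σ μ {h : ℝ → ℝ | Monotone h ∧ MemLp h 2 μ} := by
  have := hσ.1
  have hwd := lotWellDefined_of_absolutelyContinuous hσ hm
  refine ⟨fun h hh => hh.2, fun h hh => ?_⟩
  obtain ⟨hmono, hL⟩ := hh
  have hT := hwd.isOptimalTransportMap_lot hμ
  have hν := hμ.map hL
  have hR := hwd.isOptimalTransportMap_lot hν
  have hTm : AEMeasurable (lot σ μ) σ := (Lp.aestronglyMeasurable _).aemeasurable
  have hRm : AEMeasurable (lot σ (μ.map h)) σ := (Lp.aestronglyMeasurable _).aemeasurable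
  obtain ⟨A, hA, hTA⟩ := hT.exists_monotoneOn hσ hμ hm
  obtain ⟨B, hB, hRB⟩ := hR.exists_monotoneOn hσ hν hm
  refine ae_eq_of_monotoneOn_of_map_eq (inter_mem hB hA) (hRB.mono Set.inter_subset_left)
    (hmono.comp_monotoneOn (hTA.mono Set.inter_subset_right)) hRm
    (hmono.measurable.comp_aemeasurable hTm) ?_
  rw [hR.map_eq, ← AEMeasurable.map_map_of_aemeasurable hmono.measurable.aemeasurable hTm,
    hT.map_eq]

end Compatibility

end LinOT

theorem mainTheorem10 :
    (∀ σ μ : Measure ℝ, LinOT.MemP2 σ → LinOT.MemP2 μ → σ ≪ volume →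
      LinOT.LotWellDefined σ ∧
      LinOT.IsCompatible σ μ {h : ℝ → ℝ | Monotone h ∧ MemLp h 2 μ}) ∧
    (∀ n : ℕ, 1 ≤ n → ∀ σ μ : Measure (EuclideanSpace ℝ (Fin n)),
      LinOT.MemP2 σ → LinOT.MemP2 μ → σ ≪ volume →
      LinOT.LotWellDefined σ ∧
      LinOT.IsCompatible σ μ (LinOT.shiftsAndScalings (EuclideanSpace ℝ (Fin n)))) := by
  refine ⟨fun σ μ hσ hμ hm => ⟨LinOT.lotWellDefined_of_absolutelyContinuous hσ hm,
    LinOT.isCompatible_monotone hσ hμ hm⟩, fun n _ σ μ hσ hμ hm => ?_⟩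
  have hwd := LinOT.lotWellDefined_of_absolutelyContinuous hσ hm
  exact ⟨hwd, LinOT.isCompatible_shiftsAndScalings hσ hμ hwd⟩
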